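/- **Theorem 1.1.** Let $K$ be any field and let $A$ be an associative unital $K$-algebra with no zero divisors, generated by a finite set $S\ni 1$. Assume that $A$ is amenable: there are finite dimensional subspaces $W_1\subseteq W_2\subseteq\dots$ with $\bigcup_m W_m=A$ such that $\dim_K(VW_m)/\dim_K(W_m)\to 1$ as $m\to\infty$ for every nonzero finite dimensional subspace $V\le A$, where $VW_m$ is the span of the products $vw$ with $v\in V$, $w\in W_m$. For $x\in M_n(K)$ with $n\ge 1$ let $rk(x)=\frac1n\,\mathrm{rank}(x)$, and let $A_{\le d}$ be the span of all monomials of length at most $d$ in elements of $S$. For $d\ge 1$, a linear map $\phi:A\to M_n(K)$ is a *$d$-approximation* if there is a subspace $U\le K^n$ with $\dim U\ge(1-\frac1d)n$ and $\phi(xy)u=\phi(x)\phi(y)u$ for all $x,y\in A_{\le d}$, $u\in U$, and if $rk(\phi(a))\ge 1-\frac1d$ for every nonzero $a\in A_{\le d}$. A *linear sofic approximation* of $A$ is a sequence of linear maps $\phi_k:A\to M_{n_k}(K)$, $n_k\ge 1$, such that for every $d\ge 1$ the map $\phi_k$ is a $d$-approximation for all sufficiently large $k$. For a nonprincipal ultrafilter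 $\omega$ on $\mathbb N$, the metric ultraproduct $\prod_{k\to\omega}M_{n_k}(K)$ is the quotient of $\prod_k M_{n_k}(K)$ by the two-sided ideal of all sequences $(x_k)$ with $\lim_{k\to\omega}rk(x_k)=0$. Then there is a unique conjugacy class of linear sofic approximations of $A$, that is: 1. for some sequence of integers $n_k\ge 1$ there is a linear sofic approximation $\phi_k:A\to M_{n_k}(K)$; 2. for every sequence $n_k\ge 1$, any two linear sofic approximations $\phi_k,\psi_k:A\to M_{n_k}(K)$ of $A$ and every nonprincipal ultrafilter $\omega$ on $\mathbb N$, the sequences $(\phi_k)$ and $(\psi_k)$ are conjugate: there are $M_k\in GL_{n_k}(K)$ with classes $M=(M_k)$ and $M^{-1}=(M_k^{-1})$ such that $(\phi_k(a))=M\,(\psi_k(a))\,M^{-1}$ in $\prod_{k\to\omega}M_{n_k}(K)$ for all $a\in A$. -/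

import Mathlib

namespace LinearSofic

open Filter Topology
open scoped Pointwise

/-- A `K`-algebra is amenable if it is exhausted by an increasing sequence of finite dimensional
subspaces `W m` with `dim (V W m) / dim (W m) → 1` for every nonzero finite dimensional
subspace `V`. Here `V * W m` is the span of all products. -/
def IsAmenable (K A : Type*) [Field K] [Ring A] [Algebra K A] : Prop :=
  ∃ W : ℕ → Submodule K A,
    (∀ m, FiniteDimensional K (W m)) ∧ Monotone W ∧ (∀ a : A, ∃ m, a ∈ W m) ∧
    ∀ V : Submodule K A, FiniteDimensional K V → V ≠ ⊥ →
      Tendsto (fun m => (Module.finrank K (V * W m : Submodule K A) : ℝ) /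
        (Module.finrank K (W m) : ℝ)) atTop (𝓝 1)

/-- The normalized rank `rank x / n` of an `n × n` matrix. -/
noncomputable def rk {K : Type*} [Field K] {n : ℕ} (x : Matrix (Fin n) (Fin n) K) : ℝ :=
  (x.rank : ℝ) / (n : ℝ)

/-- The span of `S ^ r`. As `1 ∈ S` in all uses, `S ^ r` (the set of products of `r` elements
of `S`) is the set of monomials in `S` of length at most `r`. -/
def filtration (K : Type*) {A : Type*} [Field K] [Ring A] [Algebra K A] (S : Finset A) (r : ℕ) :
    Submodule K A :=
  Submodule.span K ((S : Set A) ^ r)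

/-- `φ` is a `d`-approximation of `(A, S)` (meaningful for `d, n ≥ 1`). -/
def IsApproximation {K A : Type*} [Field K] [Ring A] [Algebra K A] (S : Finset A) (d : ℕ) {n : ℕ}
    (φ : A →ₗ[K] Matrix (Fin n) (Fin n) K) : Prop :=
  (∃ U : Submodule K (Fin n → K),
    (∀ x ∈ filtration K S d, ∀ y ∈ filtration K S d, ∀ u ∈ U,
      (φ (x * y)).mulVec u = (φ x * φ y).mulVec u) ∧
    (1 - 1 / (d : ℝ)) * (n : ℝ) ≤ (Module.finrank K U : ℝ)) ∧
  ∀ a ∈ filtration K S d, a ≠ 0 → 1 - 1 / (d : ℝ) ≤ rk (φ a)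

/-- A sequence of linear maps `φ k : A → M_{n k}(K)` with `n k ≥ 1` is a linear sofic
approximation if for each `d ≥ 1`, `φ k` is a `d`-approximation for all large `k`. -/
def IsLinearSoficApproximation {K A : Type*} [Field K] [Ring A] [Algebra K A] (S : Finset A)
    {n : ℕ → ℕ} (φ : ∀ k, A →ₗ[K] Matrix (Fin (n k)) (Fin (n k)) K) : Prop :=
  (∀ k, 0 < n k) ∧ ∀ d : ℕ, 0 < d → ∀ᶠ k in atTop, IsApproximation S d (φ k)

theorem rk_nonneg {K : Type*} [Field K] {n : ℕ} (x : Matrix (Fin n) (Fin n) K) : 0 ≤ rk x := by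
  unfold rk; positivity

theorem rk_zero {K : Type*} [Field K] {n : ℕ} : rk (0 : Matrix (Fin n) (Fin n) K) = 0 := by
  simp [rk]

theorem rk_add_le {K : Type*} [Field K] {n : ℕ} (x y : Matrix (Fin n) (Fin n) K) :
    rk (x + y) ≤ rk x + rk y := by
  unfold rk
  rw [← add_div]
  gcongr
  have h : (x + y).rank ≤ x.rank + y.rank := by
    unfold Matrix.rank
    rw [Matrix.mulVecLin_add]
    exact (Submodule.finrank_mono (LinearMap.range_add_le _ _)).trans
      (Submodule.finrank_add_le_finrank_add_finrank _ _)
  exact_mod_cast h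

theorem rk_neg {K : Type*} [Field K] {n : ℕ} (x : Matrix (Fin n) (Fin n) K) :
    rk (-x) = rk x := by
  have h : (-x).rank = x.rank := by
    rw [← neg_one_smul K x]
    apply le_antisymm
    · rw [← Matrix.mul_one x, ← Matrix.mul_smul]
      simpa using Matrix.rank_mul_le_left x ((-1 : K) • (1 : Matrix (Fin n) (Fin n) K))
    · have := Matrix.rank_mul_le_left ((-1 : K) • x) ((-1 : K) • (1 : Matrix (Fin n) (Fin n) K))
      simpa using this
  rw [rk, rk, h]

theorem rk_mul_le_left {K : Type*} [Field K] {n : ℕ} (x y : Matrix (Fin n) (Fin n) K) :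
    rk (x * y) ≤ rk x := by
  unfold rk
  gcongr
  exact Matrix.rank_mul_le_left x y

theorem rk_mul_le_right {K : Type*} [Field K] {n : ℕ} (x y : Matrix (Fin n) (Fin n) K) :
    rk (x * y) ≤ rk y := by
  unfold rk
  gcongr
  exact Matrix.rank_mul_le_right x y

/-- The two-sided ideal of `∏ k, M_{n k}(K)` of all `(x k)` with `lim_{k → ω} rk (x k) = 0`. -/
noncomputable def nullIdeal (K : Type*) [Field K] (n : ℕ → ℕ) (ω : Ultrafilter ℕ) :
    TwoSidedIdeal (∀ k, Matrix (Fin (n k)) (Fin (n k)) K) :=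
  TwoSidedIdeal.mk'
    {x | Tendsto (fun k => rk (x k)) (ω : Filter ℕ) (𝓝 0)}
    (by simp [rk_zero])
    (fun {x y} hx hy => by
      have h := Tendsto.add hx hy
      rw [add_zero] at h
      exact squeeze_zero (fun k => rk_nonneg _) (fun k => rk_add_le (x k) (y k)) h)
    (fun {x} hx => by simpa [rk_neg] using hx)
    (fun {x y} hy => squeeze_zero (fun k => rk_nonneg _) (fun k => rk_mul_le_right (x k) (y k)) hy)
    (fun {x y} hx => squeeze_zero (fun k => rk_nonneg _) (fun k => rk_mul_le_left (x k) (y k)) hx)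

/-- The metric ultraproduct `∏_{k → ω} M_{n k}(K)`. -/
abbrev MetricUltraproduct (K : Type*) [Field K] (n : ℕ → ℕ) (ω : Ultrafilter ℕ) : Type _ :=
  (nullIdeal K n ω).ringCon.Quotient

/-- The class of a sequence of matrices in the metric ultraproduct. -/
noncomputable def toUltraproduct {K : Type*} [Field K] {n : ℕ → ℕ} (ω : Ultrafilter ℕ) :
    (∀ k, Matrix (Fin (n k)) (Fin (n k)) K) →+* MetricUltraproduct K n ω :=
  (nullIdeal K n ω).ringCon.mk'

/-- `φ` and `ψ` are conjugate (with respect to `ω`): `(φ k) = M (ψ k) M⁻¹` in the metric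
ultraproduct, for the class `M` of a sequence of invertible matrices. -/
def AreConjugate {K A : Type*} [Field K] [Ring A] [Algebra K A] {n : ℕ → ℕ} (ω : Ultrafilter ℕ)
    (φ ψ : ∀ k, A →ₗ[K] Matrix (Fin (n k)) (Fin (n k)) K) : Prop :=
  ∃ M : ∀ k, GL (Fin (n k)) K, ∀ a : A,
    toUltraproduct ω (fun k => φ k a) =
      toUltraproduct ω (fun k => (M k : Matrix (Fin (n k)) (Fin (n k)) K)) *
        toUltraproduct ω (fun k => ψ k a) *
        toUltraproduct ω (fun k => ((M k)⁻¹ : GL (Fin (n k)) K).val)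

end LinearSofic

/-! Existence: amenability yields finite dimensional `W` most of which is an interior, namely the
elements that a given finite dimensional `V` multiplies back into `W`. Left multiplication
compressed to `W` is exact on the interior, and it is injective there because `A` has no zero
divisors (`exists_isApproximation`).

Uniqueness: fix such a `W`. In an approximation `φ` nonzero elements act with small kernel, so
vectors `x i` can be picked greedily to make the spaces `φ(W) (x i)` independent copies of `W`
filling almost all of `K ^ n` (`exists_injective_tileMap`). The greedy choice rests on
`exists_injective_of_finrank_ker_le`, proved by counting over finite fields and by a maximal rank
argument over infinite ones. Tiling with `φ` and with `ψ` embeds the same power of `W` in `K ^ n`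
twice, and an automorphism matching the embeddings nearly conjugates `ψ` to `φ`, since on interiors
both act as left multiplication in `A` (`exists_rank_sub_conj_le`).

Tiling needs `n` large compared with `dim W`. Bounded `n` can persist only if `A` is finite
dimensional, hence zero or a division algebra; in the latter case fine approximations are genuine
modules, classified by dimension (`exists_conj_eq`). A diagonal choice of conjugators finishes the
proof. -/

open Module

namespace LinearSofic

/-! ### Linear algebra: maximal rank, greedy tilings, matching embeddings -/

section LinearAlgebra

variable {K W X Y : Type*} [Field K] [AddCommGroup W] [Module K W] [AddCommGroup X] [Module K X]
  [AddCommGroup Y] [Module K Y]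

/-- Over an infinite field, a linear map of maximal rank on the line `f + t g` has the property
that `g` maps its kernel into its range. -/
theorem apply_mem_range_of_forall_finrank_range_le [FiniteDimensional K W] [Infinite K]
    (f g : W →ₗ[K] Y)
    (h : ∀ t : K, finrank K (LinearMap.range (f + t • g)) ≤ finrank K (LinearMap.range f))
    {w : W} (hw : f w = 0) : g w ∈ LinearMap.range f := by
  by_contra hgw
  obtain ⟨s, hs⟩ := f.rangeRestrict.exists_rightInverse_of_surjective f.range_rangeRestrict
  have hs' : ∀ y, f (s y) = y := fun y => congrArg Subtype.val (LinearMap.congr_fun hs y)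
  -- the two maps on `range f × K` interpolated by `i + t j`
  let i : LinearMap.range f × K →ₗ[K] Y :=
    (LinearMap.range f).subtype.coprod (LinearMap.toSpanSingleton K Y (g w))
  let j : LinearMap.range f × K →ₗ[K] Y := (g ∘ₗ s).coprod 0
  have hi : LinearMap.ker i = ⊥ := by
    refine LinearMap.ker_eq_bot'.2 ?_
    rintro ⟨y, c⟩ hyc
    have hyc' : (y : Y) + c • g w = 0 := by simpa [i] using hyc
    have hc : c = 0 := by
      by_contra hc
      apply hgw
      have : g w = c⁻¹ • (-(y : Y)) := by
        rw [← eq_neg_of_add_eq_zero_right hyc', smul_smul, inv_mul_cancel₀ hc, one_smul]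
      rw [this]
      exact Submodule.smul_mem _ _ (Submodule.neg_mem _ y.2)
    subst hc
    simpa using hyc'
  obtain ⟨p, hp⟩ := i.exists_leftInverse_of_injective hi
  -- If `i + t j` kills `z ≠ 0`, applying the left inverse `p` of `i` makes `z` an eigenvector of `p
  -- ∘ j` with eigenvalue `-t⁻¹`. So all but finitely many `t ≠ 0` give an injective map.
  have hfin : Set.Finite {μ : K | End.HasEigenvalue (p ∘ₗ j) μ} :=
    End.finite_hasEigenvalue _
  obtain ⟨μ, hμ⟩ := ((hfin.insert 0).infinite_compl).nonempty
  simp only [Set.mem_compl_iff, Set.mem_insert_iff, Set.mem_ofPred_eq, not_or] at hμ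
  obtain ⟨hμ0, hμ⟩ := hμ
  set t : K := -μ⁻¹ with ht
  have ht0 : t ≠ 0 := by simpa [ht] using hμ0
  have hinj : Function.Injective (i + t • j) := by
    refine (injective_iff_map_eq_zero _).2 fun z hz => ?_
    by_contra hz0
    apply hμ
    refine End.hasEigenvalue_of_hasEigenvector (x := z) ⟨End.mem_eigenspace_iff.2 ?_, hz0⟩
    have h1 : z + t • p (j z) = 0 := by
      have := congrArg p hz
      rwa [LinearMap.add_apply, LinearMap.smul_apply, map_add, map_smul, map_zero,
        show p (i z) = z from LinearMap.congr_fun hp z] at this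
    have h2 : t • p (j z) = -z := eq_neg_of_add_eq_zero_right h1
    calc (p ∘ₗ j) z = t⁻¹ • (t • p (j z)) := by rw [smul_smul, inv_mul_cancel₀ ht0, one_smul]; rfl
      _ = μ • z := by rw [h2, ht]; simp
  have hrange : LinearMap.range (i + t • j) ≤ LinearMap.range (f + t • g) := by
    rintro _ ⟨⟨y, c⟩, rfl⟩
    -- As `f w = 0`, the second summand contributes only `c • g w`.
    refine ⟨s y + (t⁻¹ * c) • w, ?_⟩
    simp only [LinearMap.add_apply, LinearMap.smul_apply, map_add, map_smul, hw, hs', i, j,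
      LinearMap.coprod_apply, Submodule.subtype_apply, LinearMap.toSpanSingleton_apply,
      LinearMap.comp_apply, LinearMap.zero_apply, smul_add, smul_smul]
    rw [mul_right_comm, inv_mul_cancel₀ ht0, one_mul, smul_zero, smul_zero, zero_add,
      add_zero]
    abel
  -- The rank of `f + t g` is at least `rank f + 1`, against maximality.
  have h1 := (Submodule.finrank_mono hrange).trans (h t)
  rw [LinearMap.finrank_range_of_inj hinj, finrank_prod, finrank_self] at h1
  omega

/-- If every `b · w` with `w ≠ 0` has small kernel, then some `b x` is injective. -/
theorem exists_injective_of_finrank_ker_le [FiniteDimensional K W] [FiniteDimensional K X]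
    [FiniteDimensional K Y] (b : X →ₗ[K] W →ₗ[K] Y)
    (h : ∀ w, w ≠ 0 → finrank K W + finrank K (LinearMap.ker (b.flip w)) ≤ finrank K X) :
    ∃ x, Function.Injective (b x) := by
  by_contra! hcon
  have hker : ∀ x, ∃ w, w ≠ 0 ∧ b x w = 0 := fun x => by
    have := hcon x
    rw [injective_iff_map_eq_zero] at this
    push Not at this
    obtain ⟨w, h1, h2⟩ := this
    exact ⟨w, h2, h1⟩
  rcases finite_or_infinite K with hK | hK
  · have := Fintype.ofFinite K
    have : Finite W := Module.finite_of_finite K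
    have : Finite X := Module.finite_of_finite K
    have := Fintype.ofFinite W
    have := Fintype.ofFinite X
    classical
    set q := Fintype.card K with hq
    have hq1 : 1 < q := Fintype.one_lt_card
    -- `X` is covered by the kernels attached to the `q ^ dim W - 1` nonzero `w`, each of size at
    -- most `q ^ (dim X - dim W)`: together too few elements.
    have hsub : (Finset.univ : Finset X) ⊆ (Finset.univ.erase (0 : W)).biUnion
        fun w => Finset.univ.filter fun x => b x w = 0 := by
      intro x _
      obtain ⟨w, h1, h2⟩ := hker x
      simp only [Finset.mem_biUnion, Finset.mem_erase, Finset.mem_univ, and_true,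
        Finset.mem_filter, true_and]
      exact ⟨w, h1, h2⟩
    have hWX : finrank K W ≤ finrank K X := by
      obtain ⟨w, h1, -⟩ := hker 0
      have := h w h1
      omega
    have hcard := (Finset.card_le_card hsub).trans (Finset.card_biUnion_le_card_mul _ _
      (q ^ (finrank K X - finrank K W)) ?_)
    · rw [Finset.card_univ, Finset.card_erase_of_mem (Finset.mem_univ _), Finset.card_univ,
        Module.card_eq_pow_finrank (K := K) (V := X), Module.card_eq_pow_finrank (K := K) (V := W),
        ← hq, Nat.sub_mul, ← pow_add, Nat.add_sub_cancel' hWX, one_mul] at hcard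
      have h1 : 0 < q ^ (finrank K X - finrank K W) := by positivity
      have h2 : 0 < q ^ finrank K X := by positivity
      omega
    · intro w hw
      have hw0 : w ≠ 0 := Finset.ne_of_mem_erase hw
      have : (Finset.univ.filter fun x => b x w = 0).card
          = Fintype.card (LinearMap.ker (b.flip w)) := by
        rw [Fintype.card_subtype]
        congr 1
      rw [this, Module.card_eq_pow_finrank (K := K), ← hq]
      exact Nat.pow_le_pow_right (by omega) (by have := h w hw0; omega)
  · obtain ⟨x, hx⟩ : ∃ x, ∀ y, finrank K (LinearMap.range (b y))
        ≤ finrank K (LinearMap.range (b x)) := by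
      obtain ⟨_, ⟨x, rfl⟩, hx⟩ := Set.exists_max_image
        (Set.range fun x => finrank K (LinearMap.range (b x))) id
        ((Set.finite_Iic (finrank K W)).subset (by
          rintro _ ⟨x, rfl⟩
          exact LinearMap.finrank_range_le _)) ⟨_, 0, rfl⟩
      exact ⟨x, fun y => hx _ ⟨y, rfl⟩⟩
    obtain ⟨w, hw0, hw⟩ := hker x
    -- By maximality of the rank of `b x`, every `b y` sends `w ∈ ker (b x)` into the range of `b
    -- x`. That range has dimension below `dim W`, which makes the kernel of `b.flip w` too large.
    have hle : LinearMap.range (b.flip w) ≤ LinearMap.range (b x) := by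
      rintro _ ⟨y, rfl⟩
      refine apply_mem_range_of_forall_finrank_range_le (b x) (b y) (fun t => ?_) hw
      rw [← map_smul, ← map_add]
      exact hx _
    have h1 := Submodule.finrank_mono hle
    have h2 := (b.flip w).finrank_range_add_finrank_ker
    have h3 := (b x).finrank_range_add_finrank_ker
    have h4 : 0 < finrank K (LinearMap.ker (b x)) :=
      Module.finrank_pos_iff_exists_ne_zero.2 ⟨⟨w, hw⟩, fun h => hw0 (congrArg Subtype.val h)⟩
    have h5 := h w hw0
    omega

theorem finrank_ker_domRestrict_le [FiniteDimensional K X] (g : X →ₗ[K] Y) (U : Submodule K X) :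
    finrank K (LinearMap.ker (g.domRestrict U)) ≤ finrank K (LinearMap.ker g) := by
  rw [← Submodule.finrank_map_subtype_eq]
  refine Submodule.finrank_mono ?_
  rintro _ ⟨x, hx, rfl⟩
  exact hx

theorem finrank_comap_le [FiniteDimensional K X] [FiniteDimensional K Y] (g : X →ₗ[K] Y)
    (T : Submodule K Y) :
    finrank K (T.comap g) ≤ finrank K T + finrank K (LinearMap.ker g) := by
  have h := (g.domRestrict (T.comap g)).finrank_range_add_finrank_ker
  have h1 : LinearMap.range (g.domRestrict (T.comap g)) ≤ T := by
    rintro _ ⟨x, rfl⟩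
    exact x.2
  have h2 := Submodule.finrank_mono h1
  have h3 := finrank_ker_domRestrict_le g (T.comap g)
  omega

/-- The map `(w i) ↦ ∑ i, f (w i) (x i)`. -/
def tileMap {E : Type*} [AddCommGroup E] [Module K E] (f : W →ₗ[K] End K E) {r : ℕ}
    (x : Fin r → E) : (Fin r → W) →ₗ[K] E :=
  ∑ i, (f.flip (x i)) ∘ₗ LinearMap.proj i

theorem tileMap_apply {E : Type*} [AddCommGroup E] [Module K E] (f : W →ₗ[K] End K E) {r : ℕ}
    (x : Fin r → E) (w : Fin r → W) : tileMap f x w = ∑ i, f (w i) (x i) := by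
  simp [tileMap]

/-- A linear family of operators with small kernels admits an almost exhausting tiling. -/
theorem exists_injective_tileMap {E : Type*} [AddCommGroup E] [Module K E]
    [FiniteDimensional K W] [FiniteDimensional K E]
    (f : W →ₗ[K] End K E) (U : Submodule K E) {c : ℕ}
    (hf : ∀ w, w ≠ 0 → finrank K (LinearMap.ker (f w)) ≤ c) (r : ℕ)
    (hr : r * finrank K W + c ≤ finrank K U) :
    ∃ x : Fin r → E, (∀ i, x i ∈ U) ∧ Function.Injective (tileMap f x) := by
  induction r with
  | zero => exact ⟨Fin.elim0, fun i => i.elim0, fun x y _ => Subsingleton.elim _ _⟩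
  | succ r ih =>
    rw [Nat.succ_mul] at hr
    obtain ⟨x, hxU, hx⟩ := ih (by omega)
    set T := LinearMap.range (tileMap f x) with hT
    have hTr : finrank K T = r * finrank K W := by
      rw [hT, LinearMap.finrank_range_of_inj hx, Module.finrank_pi_fintype]
      simp
    -- The next base point `y` must make `w ↦ f w y` injective modulo the tiles already placed. For
    -- `w ≠ 0` the bad `y` form a space of dimension at most `dim T + c`, which `hr` leaves room
    -- for.
    let b : U →ₗ[K] W →ₗ[K] E ⧸ T := (f.flip.domRestrict U).compr₂ T.mkQ
    obtain ⟨y, hy⟩ := exists_injective_of_finrank_ker_le b (by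
      intro w hw
      have h1 : LinearMap.ker (b.flip w) = T.comap ((f w).domRestrict U) := by
        ext u
        simp [b]
      have h2 := finrank_ker_domRestrict_le (f w) U
      have h3 := finrank_comap_le ((f w).domRestrict U) T
      have h4 := hf w hw
      rw [h1]
      omega)
    refine ⟨Fin.cons y x, fun i => ?_, ?_⟩
    · refine Fin.cases ?_ (fun i => ?_) i
      · simp
      · simpa using hxU i
    · refine (injective_iff_map_eq_zero _).2 fun w hw => ?_
      rw [tileMap_apply, Fin.sum_univ_succ] at hw
      simp only [Fin.cons_zero, Fin.cons_succ] at hw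
      have h0 : w 0 = 0 := by
        refine (injective_iff_map_eq_zero _).1 hy _ ?_
        have : f (w 0) y ∈ T := by
          rw [eq_neg_of_add_eq_zero_left hw]
          refine T.neg_mem ⟨fun i => w i.succ, tileMap_apply _ _ _⟩
        simpa [b] using this
      have h1 : (fun i => w (Fin.succ i)) = 0 := by
        refine (injective_iff_map_eq_zero _).1 hx _ ?_
        rw [tileMap_apply]
        simpa [h0] using hw
      ext i
      refine Fin.cases h0 (fun i => ?_) i
      exact congrFun h1 i

/-- Two embeddings into a finite dimensional space differ by an automorphism. -/
theorem exists_linearEquiv_comp_eq {Z E E' : Type*} [AddCommGroup Z] [Module K Z] [AddCommGroup E]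
    [Module K E] [FiniteDimensional K E] [AddCommGroup E'] [Module K E'] [FiniteDimensional K E']
    (hE : finrank K E = finrank K E')
    {F : Z →ₗ[K] E} {G : Z →ₗ[K] E'} (hF : Function.Injective F) (hG : Function.Injective G) :
    ∃ e : E ≃ₗ[K] E', ∀ z, e (F z) = G z := by
  obtain ⟨P, hP⟩ := (LinearMap.range F).exists_isCompl
  obtain ⟨Q, hQ⟩ := (LinearMap.range G).exists_isCompl
  have h1 := Submodule.finrank_add_eq_of_isCompl hP
  have h2 := Submodule.finrank_add_eq_of_isCompl hQ
  let e₁ := (LinearEquiv.ofInjective F hF).symm.trans (LinearEquiv.ofInjective G hG)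
  have h3 := e₁.finrank_eq
  let e₂ : P ≃ₗ[K] Q := LinearEquiv.ofFinrankEq _ _ (by omega)
  refine ⟨(Submodule.prodEquivOfIsCompl _ _ hP).symm.trans
    ((e₁.prodCongr e₂).trans (Submodule.prodEquivOfIsCompl _ _ hQ)), fun z => ?_⟩
  have h4 : (Submodule.prodEquivOfIsCompl _ _ hP).symm (F z)
      = (LinearEquiv.ofInjective F hF z, 0) :=
    Submodule.prodEquivOfIsCompl_symm_apply_left _ _ hP (LinearEquiv.ofInjective F hF z)
  simp [h4, e₁]

end LinearAlgebra

/-! ### Word length filtration, interiors, and existence of approximations -/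

section Filtration

open scoped Pointwise

variable {K A : Type*} [Field K] [Ring A] [Algebra K A] {S : Finset A}

theorem filtration_eq_pow (S : Finset A) (r : ℕ) :
    filtration K S r = Submodule.span K (S : Set A) ^ r :=
  (Submodule.span_pow _ _).symm

instance (S : Finset A) (r : ℕ) : FiniteDimensional K (filtration K S r) := by
  rw [filtration_eq_pow]
  have : (Submodule.span K (S : Set A)).FG := ⟨S, rfl⟩
  exact Module.Finite.iff_fg.2 (this.pow r)

theorem one_mem_filtration (hS : (1 : A) ∈ S) (r : ℕ) : (1 : A) ∈ filtration K S r :=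
  Submodule.subset_span (Set.one_mem_pow hS)

theorem mul_mem_filtration {r s : ℕ} {a b : A} (ha : a ∈ filtration K S r)
    (hb : b ∈ filtration K S s) : a * b ∈ filtration K S (r + s) := by
  rw [filtration_eq_pow] at *
  rw [pow_add]
  exact Submodule.mul_mem_mul ha hb

theorem filtration_mono (hS : (1 : A) ∈ S) : Monotone (filtration K S) :=
  fun _ _ h => Submodule.span_mono (Set.pow_subset_pow_right hS h)

theorem exists_mem_filtration (hS : (1 : A) ∈ S) (hgen : Algebra.adjoin K (S : Set A) = ⊤)
    (a : A) : ∃ r, a ∈ filtration K S r := by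
  have ha : a ∈ Algebra.adjoin K (S : Set A) := hgen ▸ Algebra.mem_top
  induction ha using Algebra.adjoin_induction with
  | mem x hx => exact ⟨1, Submodule.subset_span (by simpa only [pow_one] using hx)⟩
  | algebraMap c =>
    refine ⟨0, ?_⟩
    rw [Algebra.algebraMap_eq_smul_one]
    exact Submodule.smul_mem _ _ (one_mem_filtration hS 0)
  | add x y _ _ hx hy =>
    obtain ⟨r, hr⟩ := hx
    obtain ⟨s, hs⟩ := hy
    exact ⟨max r s, Submodule.add_mem _ (filtration_mono hS (le_max_left _ _) hr)
      (filtration_mono hS (le_max_right _ _) hs)⟩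
  | mul x y _ _ hx hy =>
    obtain ⟨r, hr⟩ := hx
    obtain ⟨s, hs⟩ := hy
    exact ⟨r + s, mul_mem_filtration hr hs⟩

theorem exists_le_filtration (hS : (1 : A) ∈ S) (hgen : Algebra.adjoin K (S : Set A) = ⊤)
    (W : Submodule K A) [FiniteDimensional K W] : ∃ r, W ≤ filtration K S r := by
  obtain ⟨s, rfl⟩ : W.FG := Module.Finite.iff_fg.1 inferInstance
  choose r hr using exists_mem_filtration (K := K) hS hgen
  exact ⟨s.sup r, Submodule.span_le.2 fun a ha =>
    filtration_mono hS (Finset.le_sup (f := r) ha) (hr a)⟩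

theorem exists_le_finrank_filtration (hS : (1 : A) ∈ S)
    (hgen : Algebra.adjoin K (S : Set A) = ⊤) (hA : ¬ FiniteDimensional K A) (N : ℕ) :
    ∃ r, N ≤ finrank K (filtration K S r) := by
  obtain ⟨f, hf⟩ := exists_linearIndependent_of_le_rank (R := K) (M := A) (n := N)
    (Cardinal.natCast_lt_aleph0.le.trans
      (not_lt.1 fun h => hA (Module.rank_lt_aleph0_iff.1 h)))
  have : FiniteDimensional K (Submodule.span K (Set.range f)) :=
    FiniteDimensional.span_of_finite K (Set.finite_range f)
  obtain ⟨r, hr⟩ := exists_le_filtration hS hgen (Submodule.span K (Set.range f))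
  refine ⟨r, ?_⟩
  have := Submodule.finrank_mono hr
  rwa [finrank_span_eq_card hf, Fintype.card_fin] at this

theorem IsApproximation.mono {n : ℕ} {φ : A →ₗ[K] Matrix (Fin n) (Fin n) K} {d e : ℕ}
    (hS : (1 : A) ∈ S) (hφ : IsApproximation S e φ) (hd : 0 < d) (hde : d ≤ e) :
    IsApproximation S d φ := by
  have hle := filtration_mono (K := K) hS hde
  have h1 : 1 - 1 / (d : ℝ) ≤ 1 - 1 / (e : ℝ) := by gcongr
  obtain ⟨⟨U, hU, hUn⟩, hrk⟩ := hφ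
  exact ⟨⟨U, fun x hx y hy => hU x (hle hx) y (hle hy), le_trans (by gcongr) hUn⟩,
    fun a ha ha0 => h1.trans (hrk a (hle ha) ha0)⟩

/-- The subspace of those `w ∈ W` with `V w ⊆ W`. -/
def interior (V W : Submodule K A) : Submodule K A where
  carrier := {w | w ∈ W ∧ ∀ v ∈ V, v * w ∈ W}
  zero_mem' := ⟨W.zero_mem, fun v _ => by simp⟩
  add_mem' := fun hx hy => ⟨W.add_mem hx.1 hy.1, fun v hv => by
    rw [mul_add]; exact W.add_mem (hx.2 v hv) (hy.2 v hv)⟩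
  smul_mem' := fun c x hx => ⟨W.smul_mem c hx.1, fun v hv => by
    rw [mul_smul_comm]; exact W.smul_mem c (hx.2 v hv)⟩

theorem interior_le (V W : Submodule K A) : interior V W ≤ W := fun _ h => h.1

/-- The interior is the kernel of the multiplication map `W → Hom(V, VW / W)`, whose target has
dimension `dim V * (dim VW - dim W)`. -/
theorem finrank_le_finrank_interior_add (V W : Submodule K A) [FiniteDimensional K V]
    [FiniteDimensional K W] (hV : (1 : A) ∈ V) :
    finrank K W ≤ finrank K (interior V W) +
      finrank K V * (finrank K (V * W : Submodule K A) - finrank K W) := by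
  have hle : W ≤ V * W := fun w hw => by simpa using Submodule.mul_mem_mul hV hw
  have hfin : FiniteDimensional K (V * W : Submodule K A) :=
    Module.Finite.iff_fg.2 ((Module.Finite.iff_fg.1 ‹_›).mul (Module.Finite.iff_fg.1 ‹_›))
  let Q := (V * W : Submodule K A) ⧸ W.submoduleOf (V * W)
  let Φ : W →ₗ[K] V →ₗ[K] Q := LinearMap.mk₂ K
    (fun w v => (W.submoduleOf (V * W)).mkQ ⟨v * w, Submodule.mul_mem_mul v.2 w.2⟩)
    (fun w w' v => by rw [← map_add]; congr 1; ext; simp [mul_add])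
    (fun c w v => by rw [← map_smul]; congr 1; ext; simp)
    (fun w v v' => by rw [← map_add]; congr 1; ext; simp [add_mul])
    (fun c w v => by rw [← map_smul]; congr 1; ext; simp)
  have hΦ : ∀ w v, Φ w v = 0 ↔ (v * w : A) ∈ W := fun w v => Submodule.Quotient.mk_eq_zero _
  have hker : (LinearMap.ker Φ).map W.subtype = interior V W := by
    ext w
    simp only [Submodule.mem_map, LinearMap.mem_ker]
    constructor
    · rintro ⟨w, hw, rfl⟩
      refine ⟨w.2, fun v hv => ?_⟩
      exact (hΦ _ ⟨v, hv⟩).1 (LinearMap.congr_fun hw ⟨v, hv⟩)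
    · rintro ⟨hw, h⟩
      refine ⟨⟨w, hw⟩, ?_, rfl⟩
      ext v
      exact (hΦ _ v).2 (h v v.2)
  have h1 : finrank K (LinearMap.ker Φ) = finrank K (interior V W) := by
    rw [← hker, Submodule.finrank_map_subtype_eq]
  have h2 := Φ.finrank_range_add_finrank_ker
  have h3 := Submodule.finrank_le (LinearMap.range Φ)
  have h4 : finrank K Q = finrank K (V * W : Submodule K A) - finrank K W := by
    have : finrank K Q + _ = _ := (W.submoduleOf (V * W)).finrank_quotient_add_finrank
    rw [(Submodule.submoduleOfEquivOfLe hle).finrank_eq] at this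
    omega
  rw [Module.finrank_linearMap, h4] at h3
  omega

theorem IsAmenable.exists_le_finrank_interior [Nontrivial A] (hA : IsAmenable K A)
    (V : Submodule K A) [FiniteDimensional K V] (hV : (1 : A) ∈ V) {η : ℝ} (hη : 0 < η) :
    ∃ W : Submodule K A, FiniteDimensional K W ∧ 0 < finrank K W ∧
      (1 - η) * finrank K W ≤ finrank K (interior V W) := by
  obtain ⟨W, hfin, -, -, hW⟩ := hA
  have hV0 : V ≠ ⊥ := fun h => one_ne_zero ((Submodule.mem_bot K).1 (h ▸ hV))
  have hdV : 0 < finrank K V := Submodule.one_le_finrank_iff.2 hV0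
  have hdV' : (0 : ℝ) < finrank K V := by exact_mod_cast hdV
  have h := hW V inferInstance hV0
  -- The tolerance `η / dim V` absorbs the factor `dim V` of the interior estimate. Positivity of
  -- the ratio forces `W m ≠ 0`, because division by zero gives `0`.
  obtain ⟨m, h1, h2⟩ := ((h.eventually (lt_mem_nhds one_pos)).and
    (h.eventually (gt_mem_nhds (show (1 : ℝ) < 1 + η / finrank K V by
      linarith [div_pos hη hdV'])))).exists
  have := hfin m
  have h3 : 0 < finrank K (W m) := by
    rcases Nat.eq_zero_or_pos (finrank K (W m)) with h0 | h0
    · simp [h0] at h1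
    · exact h0
  refine ⟨W m, hfin m, h3, ?_⟩
  have h3' : (0 : ℝ) < finrank K (W m) := by exact_mod_cast h3
  have hle : W m ≤ V * W m := fun w hw => by simpa using Submodule.mul_mem_mul hV hw
  have hfin' : FiniteDimensional K (V * W m : Submodule K A) :=
    Module.Finite.iff_fg.2 ((Module.Finite.iff_fg.1 ‹_›).mul (Module.Finite.iff_fg.1 ‹_›))
  have h4 := finrank_le_finrank_interior_add V (W m) hV
  have h5 : (finrank K (W m) : ℝ) ≤ finrank K (interior V (W m)) +
      finrank K V * (finrank K (V * W m : Submodule K A) - finrank K (W m)) := by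
    rw [← Nat.cast_sub (Submodule.finrank_mono hle)]
    exact_mod_cast h4
  rw [div_lt_iff₀ h3'] at h2
  have h6 : (finrank K V : ℝ) * (finrank K (V * W m : Submodule K A) - finrank K (W m))
      ≤ finrank K V * (η / finrank K V * finrank K (W m)) := by
    gcongr
    linarith
  have h7 : (finrank K V : ℝ) * (η / finrank K V * finrank K (W m)) = η * finrank K (W m) := by
    field_simp
  linarith

/-- Compressing left multiplication to a finite dimensional subspace with large interior gives an
approximation. -/
theorem exists_isApproximation [NoZeroDivisors A] (hS : (1 : A) ∈ S) {d : ℕ}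
    (W : Submodule K A) [FiniteDimensional K W] (hW0 : 0 < finrank K W)
    (hW : (1 - 1 / (d : ℝ)) * finrank K W ≤ finrank K (interior (filtration K S (d + d)) W)) :
    ∃ φ : A →ₗ[K] Matrix (Fin (finrank K W)) (Fin (finrank K W)) K, IsApproximation S d φ := by
  obtain ⟨P, hP⟩ := W.subtype.exists_leftInverse_of_injective W.ker_subtype
  have hP' : ∀ a (ha : a ∈ W), P a = ⟨a, ha⟩ := fun a ha => LinearMap.congr_fun hP ⟨a, ha⟩
  let e : W ≃ₗ[K] (Fin (finrank K W) → K) := (finBasis K W).equivFun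
  let c : A →ₗ[K] W →ₗ[K] W := ((LinearMap.mul K A).compl₂ W.subtype).compr₂ P
  have hc : ∀ a w, c a w = P (a * w) := fun a w => rfl
  let φ : A →ₗ[K] Matrix (Fin (finrank K W)) (Fin (finrank K W)) K :=
    LinearMap.toMatrix'.toLinearMap ∘ₗ e.conj.toLinearMap ∘ₗ c
  have hφ : ∀ a w, (φ a).mulVec (e w) = e (c a w) := fun a w => by
    simp [φ, LinearMap.toMatrix'_mulVec, LinearEquiv.conj_apply]
  -- Words of length `d + d` include the products `x * y`, so the projection `P` fixes both `y * w`
  -- and `x * y * w` for `w ∈ I`.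
  set I := interior (filtration K S (d + d)) W with hI
  have hd : filtration K S d ≤ filtration K S (d + d) := filtration_mono hS (by omega)
  let U := (I.submoduleOf W).map e.toLinearMap
  have hU : finrank K U = finrank K I := by
    rw [LinearEquiv.finrank_map_eq, (Submodule.submoduleOfEquivOfLe (interior_le _ W)).finrank_eq]
  refine ⟨φ, ⟨U, ?_, by rwa [hU]⟩, fun a ha ha0 => ?_⟩
  · rintro x hx y hy _ ⟨w, hw, rfl⟩
    have hw' : (w : A) ∈ I := hw
    have h1 := hw'.2 y (hd hy)
    have h2 := hw'.2 (x * y) (mul_mem_filtration hx hy)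
    rw [← Matrix.mulVec_mulVec]
    simp only [LinearEquiv.coe_coe, hφ, hc]
    rw [hP' _ h1, hP' _ h2, ← mul_assoc, hP' _ h2]
  · have hW0' : (0 : ℝ) < finrank K W := by exact_mod_cast hW0
    rw [rk, le_div_iff₀ hW0']
    refine hW.trans ?_
    -- On `I` the compression is honest multiplication by `a ≠ 0`, hence injective.
    have : finrank K (I.submoduleOf W) ≤ (φ a).rank := by
      refine LinearMap.finrank_le_finrank_of_injective
        (f := ((φ a).mulVecLin.rangeRestrict ∘ₗ e.toLinearMap ∘ₗ (I.submoduleOf W).subtype)) ?_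
      refine (injective_iff_map_eq_zero _).2 fun w hw => ?_
      have h1 : (φ a).mulVec (e (w : W)) = 0 := congrArg Subtype.val hw
      have hw' : ((w : W) : A) ∈ I := w.2
      rw [hφ, LinearEquiv.map_eq_zero_iff, hc, hP' _ (hw'.2 a (hd ha))] at h1
      have h2 : a * ((w : W) : A) = 0 := congrArg Subtype.val h1
      exact Subtype.ext (Subtype.ext ((mul_eq_zero.1 h2).resolve_left ha0))
    rw [(Submodule.submoduleOfEquivOfLe (interior_le _ W)).finrank_eq] at this
    exact_mod_cast this

theorem exists_isLinearSoficApproximation [NoZeroDivisors A] (hS : (1 : A) ∈ S)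
    (hA : IsAmenable K A) :
    ∃ (n : ℕ → ℕ) (φ : ∀ k, A →ₗ[K] Matrix (Fin (n k)) (Fin (n k)) K),
      IsLinearSoficApproximation S φ := by
  rcases subsingleton_or_nontrivial A with hA' | hA'
  · refine ⟨fun _ => 1, fun _ => 0, fun _ => one_pos, fun d _ => Filter.Eventually.of_forall
      fun k => ⟨⟨⊤, by simp, ?_⟩, fun a _ ha => absurd (Subsingleton.elim a 0) ha⟩⟩
    simp
  · have h : ∀ k : ℕ, ∃ (n : ℕ) (φ : A →ₗ[K] Matrix (Fin n) (Fin n) K), 0 < n ∧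
        IsApproximation S (k + 1) φ := fun k => by
      obtain ⟨W, _, hW0, hW⟩ := hA.exists_le_finrank_interior
        (filtration K S ((k + 1) + (k + 1))) (one_mem_filtration hS _)
        (η := 1 / ((k + 1 : ℕ) : ℝ)) (by positivity)
      obtain ⟨φ, hφ⟩ := exists_isApproximation hS W hW0 hW
      exact ⟨_, φ, hW0, hφ⟩
    choose n φ hn hφ using h
    refine ⟨n, φ, hn, fun d hd => ?_⟩
    filter_upwards [Filter.eventually_ge_atTop d] with k hk
    exact (hφ k).mono hS hd (by omega)

end Filtration

/-! ### Tilings from approximations and approximate conjugacy -/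

section Conjugacy

variable {K A : Type*} [Field K] [Ring A] [Algebra K A] {S : Finset A}

/-- Codimensions are integers, so the real bound `n / d` may be rounded down; for `n < d` the defect
therefore vanishes altogether. -/
theorem IsApproximation.exists_submodule {n d : ℕ} {φ : A →ₗ[K] Matrix (Fin n) (Fin n) K}
    (hφ : IsApproximation S d φ) (hd : 0 < d) :
    ∃ U : Submodule K (Fin n → K),
      (∀ x ∈ filtration K S d, ∀ y ∈ filtration K S d, ∀ u ∈ U,
        (φ (x * y)).mulVec u = (φ x).mulVec ((φ y).mulVec u)) ∧ n ≤ finrank K U + n / d := by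
  obtain ⟨⟨U, hU, hUn⟩, -⟩ := hφ
  refine ⟨U, fun x hx y hy u hu => by rw [hU x hx y hy u hu, Matrix.mulVec_mulVec], ?_⟩
  have hd' : (0 : ℝ) < d := by exact_mod_cast hd
  have h1 : (n : ℝ) * d ≤ finrank K U * d + n := by
    have := mul_le_mul_of_nonneg_right hUn hd'.le
    have h2 : (1 - 1 / (d : ℝ)) * n * d = n * d - n := by field_simp
    linarith
  have h2 : n * d ≤ finrank K U * d + n := by exact_mod_cast h1
  have h3 : n - finrank K U ≤ n / d := by
    rw [Nat.le_div_iff_mul_le hd, Nat.sub_mul]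
    omega
  omega

theorem IsApproximation.finrank_ker_le {n d : ℕ} {φ : A →ₗ[K] Matrix (Fin n) (Fin n) K}
    (hφ : IsApproximation S d φ) (hd : 0 < d) {a : A} (ha : a ∈ filtration K S d) (ha0 : a ≠ 0) :
    finrank K (LinearMap.ker (φ a).mulVecLin) ≤ n / d := by
  rcases Nat.eq_zero_or_pos n with rfl | hn
  · exact (Submodule.finrank_le _).trans (by simp)
  have h := hφ.2 a ha ha0
  have hd' : (0 : ℝ) < d := by exact_mod_cast hd
  rw [rk, le_div_iff₀ (by exact_mod_cast hn)] at h
  have h0 := (φ a).mulVecLin.finrank_range_add_finrank_ker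
  rw [finrank_fin_fun] at h0
  change (φ a).rank + _ = n at h0
  have h1 : (n : ℝ) * d ≤ (φ a).rank * d + n := by
    have := mul_le_mul_of_nonneg_right h hd'.le
    have h2 : (1 - 1 / (d : ℝ)) * n * d = n * d - n := by field_simp
    linarith
  have h2 : n * d ≤ (φ a).rank * d + n := by exact_mod_cast h1
  rw [Nat.le_div_iff_mul_le hd]
  have h3 := congrArg (· * d) h0
  simp only [add_mul] at h3
  omega

/-- The invertible matrix of an automorphism of `K ^ n`. -/
def generalLinearOfEquiv {n : ℕ} (e : (Fin n → K) ≃ₗ[K] (Fin n → K)) : GL (Fin n) K where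
  val := LinearMap.toMatrix' e.toLinearMap
  inv := LinearMap.toMatrix' e.symm.toLinearMap
  val_inv := by rw [← LinearMap.toMatrix'_comp]; simp
  inv_val := by rw [← LinearMap.toMatrix'_comp]; simp

theorem generalLinearOfEquiv_mulVec {n : ℕ} (e : (Fin n → K) ≃ₗ[K] (Fin n → K)) (v : Fin n → K) :
    (generalLinearOfEquiv e).val.mulVec v = e v :=
  LinearMap.toMatrix'_mulVec _ _

theorem generalLinearOfEquiv_inv_mulVec {n : ℕ} (e : (Fin n → K) ≃ₗ[K] (Fin n → K))
    (v : Fin n → K) : ((generalLinearOfEquiv e)⁻¹).val.mulVec v = e.symm v :=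
  LinearMap.toMatrix'_mulVec _ _

/-- With base points in the subspace `U` where `φ` is multiplicative, `φ a` moves within a tile as
left multiplication by `a`. One `n / d` pays for the codimension of `U`, the other for the kernels
of the `φ w`. -/
theorem IsApproximation.exists_tiling {n d : ℕ} {φ : A →ₗ[K] Matrix (Fin n) (Fin n) K}
    (hφ : IsApproximation S d φ) (hd : 0 < d) {W : Submodule K A} [FiniteDimensional K W]
    (hW : W ≤ filtration K S d) {r : ℕ} (hr : r * finrank K W + 2 * (n / d) ≤ n) :
    ∃ F : (Fin r → W) →ₗ[K] (Fin n → K), Function.Injective F ∧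
      ∀ a ∈ filtration K S d, ∀ z z' : Fin r → W, (∀ i, (z' i : A) = a * z i) →
        (φ a).mulVec (F z) = F z' := by
  obtain ⟨U, hU, hUn⟩ := hφ.exists_submodule hd
  let f : W →ₗ[K] End K (Fin n → K) := Matrix.toLin'.toLinearMap ∘ₗ φ ∘ₗ W.subtype
  have hf : ∀ w v, f w v = (φ w).mulVec v := fun w v => Matrix.toLin'_apply _ _
  obtain ⟨x, hxU, hx⟩ := exists_injective_tileMap f U (c := n / d)
    (fun w hw => hφ.finrank_ker_le hd (hW w.2) fun h => hw (Subtype.ext h)) r (by omega)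
  refine ⟨tileMap f x, hx, fun a ha z z' hz => ?_⟩
  simp only [tileMap_apply, hf, Matrix.mulVec_sum, hz]
  exact Finset.sum_congr rfl fun i _ => (hU a ha _ (hW (z i).2) _ (hxU i)).symm

/-- Two approximations are nearly conjugate, as seen on the interiors of a common tiling. -/
theorem exists_rank_sub_conj_le {n d : ℕ} {φ ψ : A →ₗ[K] Matrix (Fin n) (Fin n) K}
    (hφ : IsApproximation S d φ) (hψ : IsApproximation S d ψ) (hd : 0 < d)
    {V W : Submodule K A} [FiniteDimensional K W] (hV : V ≤ filtration K S d)
    (hW : W ≤ filtration K S d) {r : ℕ} (hr : r * finrank K W + 2 * (n / d) ≤ n) :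
    ∃ M : GL (Fin n) K, ∀ a ∈ V,
      (φ a - M.val * ψ a * (M⁻¹).val).rank + r * finrank K (interior V W) ≤ n := by
  obtain ⟨F, hF, hFa⟩ := hφ.exists_tiling hd hW hr
  obtain ⟨G, hG, hGa⟩ := hψ.exists_tiling hd hW hr
  obtain ⟨e, he⟩ := exists_linearEquiv_comp_eq rfl hG hF
  refine ⟨generalLinearOfEquiv e, fun a ha => ?_⟩
  set D := φ a - (generalLinearOfEquiv e).val * ψ a * ((generalLinearOfEquiv e)⁻¹).val with hD
  have : FiniteDimensional K (interior V W) :=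
    Submodule.finiteDimensional_of_le (interior_le V W)
  have h0 := D.mulVecLin.finrank_range_add_finrank_ker
  rw [finrank_fin_fun] at h0
  change D.rank + _ = n at h0
  let ι : (Fin r → interior V W) →ₗ[K] (Fin r → W) :=
    LinearMap.pi fun i => Submodule.inclusion (interior_le V W) ∘ₗ LinearMap.proj i
  have hι : Function.Injective ι := fun z z' h => by
    ext i
    exact congrArg (fun y : Fin r → W => (y i : A)) h
  -- On tuples of interior elements, `φ a` on the `F` side and `ψ a` on the `G` side are both left
  -- multiplication by `a`, and `e` carries `G` to `F`; so the difference vanishes there.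
  have hker : ∀ z, (F ∘ₗ ι) z ∈ LinearMap.ker D.mulVecLin := fun z => by
    let z' : Fin r → W := fun i => ⟨a * z i, (z i).2.2 a ha⟩
    have h1 := hFa a (hV ha) (ι z) z' fun i => rfl
    have h2 := hGa a (hV ha) (ι z) z' fun i => rfl
    rw [LinearMap.mem_ker, Matrix.mulVecLin_apply, hD, Matrix.sub_mulVec, ← Matrix.mulVec_mulVec,
      ← Matrix.mulVec_mulVec, generalLinearOfEquiv_inv_mulVec, generalLinearOfEquiv_mulVec,
      LinearMap.comp_apply, h1, ← he (ι z), e.symm_apply_apply, h2, he, sub_self]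
  have h1 := LinearMap.finrank_le_finrank_of_injective (f := (F ∘ₗ ι).codRestrict _ hker)
    (fun z z' h => hι (hF (congrArg Subtype.val h)))
  rw [Module.finrank_pi_fintype] at h1
  simp only [Finset.sum_const, Finset.card_univ, Fintype.card_fin, smul_eq_mul] at h1
  omega

/-! ### Small matrix sizes: finite dimensional division algebras -/

/-- Modules of equal finite dimension over a finite dimensional division algebra are isomorphic. -/
theorem exists_linearEquiv_intertwining [Nontrivial A] [NoZeroDivisors A] [FiniteDimensional K A]
    {E E' : Type*} [AddCommGroup E] [Module K E] [FiniteDimensional K E] [AddCommGroup E']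
    [Module K E'] [FiniteDimensional K E'] (hE : finrank K E = finrank K E')
    (f : A →ₐ[K] End K E) (g : A →ₐ[K] End K E') :
    ∃ e : E ≃ₗ[K] E', ∀ a v, e (f a v) = g a (e v) := by
  have : IsDomain A := IsDomain.mk
  let : DivisionRing A := divisionRingOfFiniteDimensional K A
  let : Module A E := Module.compHom E f.toRingHom
  let : Module A E' := Module.compHom E' g.toRingHom
  have hs : ∀ (a : A) (v : E), a • v = f a v := fun _ _ => rfl
  have hs' : ∀ (a : A) (v : E'), a • v = g a v := fun _ _ => rfl
  have hK : IsScalarTower K A E := ⟨fun c a v => by rw [hs, hs, map_smul]; rfl⟩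
  have hK' : IsScalarTower K A E' := ⟨fun c a v => by rw [hs', hs', map_smul]; rfl⟩
  have : Module.Finite A E := Module.Finite.of_restrictScalars_finite K A E
  have : Module.Finite A E' := Module.Finite.of_restrictScalars_finite K A E'
  have h1 := finrank_mul_finrank K A E
  have h2 := finrank_mul_finrank K A E'
  -- Dimension over the division ring `A` is dimension over `K` divided by `dim A`.
  have h3 : finrank A E = finrank A E' := by
    have : 0 < finrank K A := finrank_pos
    exact Nat.eq_of_mul_eq_mul_left this (by rw [h1, h2, hE])
  let e : E ≃ₗ[A] E' := LinearEquiv.ofFinrankEq E E' h3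
  exact ⟨e.restrictScalars K, fun a v => e.map_smul a v⟩

/-- An approximation of a finite dimensional algebra by matrices of small size is exact. -/
theorem IsApproximation.exists_algHom {n d : ℕ} {φ : A →ₗ[K] Matrix (Fin n) (Fin n) K}
    [Nontrivial A] (hφ : IsApproximation S d φ) (hnd : n < d) (htop : filtration K S d = ⊤) :
    ∃ f : A →ₐ[K] End K (Fin n → K), ∀ a v, f a v = (φ a).mulVec v := by
  have hd : 0 < d := by omega
  obtain ⟨U, hU, hUn⟩ := hφ.exists_submodule hd
  have hker := fun a => hφ.finrank_ker_le hd (a := a) (htop ▸ Submodule.mem_top)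
  rw [Nat.div_eq_of_lt hnd] at hUn hker
  have hUtop : U = ⊤ := Submodule.eq_top_of_finrank_eq
    (le_antisymm (Submodule.finrank_le _) (by simpa using hUn))
  subst hUtop
  have hmul : ∀ x y v, (φ (x * y)).mulVec v = (φ x).mulVec ((φ y).mulVec v) := fun x y v =>
    hU x (htop ▸ Submodule.mem_top) y (htop ▸ Submodule.mem_top) v Submodule.mem_top
  -- `φ 1` is idempotent and injective, hence the identity.
  have hone : ∀ v, (φ 1).mulVec v = v := fun v => by
    have h1 : LinearMap.ker (φ 1).mulVecLin = ⊥ :=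
      Submodule.finrank_eq_zero.1 (Nat.le_zero.1 (hker 1 one_ne_zero))
    refine LinearMap.ker_eq_bot.1 h1 ?_
    rw [Matrix.mulVecLin_apply, Matrix.mulVecLin_apply, ← hmul, mul_one]
  refine ⟨AlgHom.ofLinearMap (Matrix.toLin'.toLinearMap ∘ₗ φ) ?_ ?_, fun a v =>
    Matrix.toLin'_apply _ _⟩
  · exact LinearMap.ext fun v => (Matrix.toLin'_apply _ _).trans (hone v)
  · exact fun x y => LinearMap.ext fun v => by
      simpa [Matrix.toLin'_apply] using hmul x y v

theorem exists_conj_eq [NoZeroDivisors A] [Nontrivial A] [FiniteDimensional K A] {n d : ℕ}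
    {φ ψ : A →ₗ[K] Matrix (Fin n) (Fin n) K} (hφ : IsApproximation S d φ)
    (hψ : IsApproximation S d ψ) (hnd : n < d) (htop : filtration K S d = ⊤) :
    ∃ M : GL (Fin n) K, ∀ a, φ a - M.val * ψ a * (M⁻¹).val = 0 := by
  obtain ⟨f, hf⟩ := hφ.exists_algHom hnd htop
  obtain ⟨g, hg⟩ := hψ.exists_algHom hnd htop
  obtain ⟨e, he⟩ := exists_linearEquiv_intertwining rfl g f
  refine ⟨generalLinearOfEquiv e, fun a => Matrix.ext_of_mulVec_single fun i => ?_⟩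
  rw [Matrix.sub_mulVec, ← Matrix.mulVec_mulVec, ← Matrix.mulVec_mulVec,
    generalLinearOfEquiv_inv_mulVec, generalLinearOfEquiv_mulVec, ← hg, he, hf,
    e.apply_symm_apply, sub_self, Matrix.zero_mulVec]

/-- Each nonzero `a` in the filtration acts injectively once `n < d`, so evaluation `a ↦ φ(a) v` at
a fixed `v ≠ 0` embeds the filtration in `K ^ n`. This excludes bounded sizes for infinite
dimensional `A`. -/
theorem IsApproximation.finrank_filtration_le {n d : ℕ}
    {φ : A →ₗ[K] Matrix (Fin n) (Fin n) K} (hφ : IsApproximation S d φ) (hn : 0 < n)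
    (hnd : n < d) : finrank K (filtration K S d) ≤ n := by
  have hker := fun a => hφ.finrank_ker_le (by omega) (a := a)
  rw [Nat.div_eq_of_lt hnd] at hker
  let v : Fin n → K := Pi.single ⟨0, hn⟩ 1
  have hv : v ≠ 0 := Pi.single_ne_zero_iff.2 one_ne_zero
  let f : filtration K S d →ₗ[K] (Fin n → K) :=
    (Matrix.toLin'.toLinearMap ∘ₗ φ ∘ₗ (filtration K S d).subtype).flip v
  have := LinearMap.finrank_le_finrank_of_injective (f := f) (by
    refine (injective_iff_map_eq_zero _).2 fun a ha => ?_
    by_contra ha0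
    have h1 : LinearMap.ker (φ a).mulVecLin = ⊥ :=
      Submodule.finrank_eq_zero.1 (Nat.le_zero.1 (hker a a.2 fun h => ha0 (Subtype.ext h)))
    have h2 : (φ a).mulVecLin v = 0 := ha
    exact hv ((LinearMap.ker_eq_bot'.1 h1) v h2))
  simpa using this

/-- Sizes at least `N` are handled by tiling, smaller ones by exact conjugacy or, in infinite
dimension, by contradiction. When tiling, three losses of `ε / 3` add up: the complement of the
interiors, the remainder smaller than one tile, and the defect `2 * (n / d)`. -/
theorem eventually_exists_rk_sub_conj_le [NoZeroDivisors A] (hS : (1 : A) ∈ S)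
    (hgen : Algebra.adjoin K (S : Set A) = ⊤) (hA : IsAmenable K A) {n : ℕ → ℕ}
    {φ ψ : ∀ k, A →ₗ[K] Matrix (Fin (n k)) (Fin (n k)) K}
    (hφ : IsLinearSoficApproximation S φ) (hψ : IsLinearSoficApproximation S ψ)
    (j : ℕ) {ε : ℝ} (hε : 0 < ε) :
    ∀ᶠ k in Filter.atTop, ∃ M : GL (Fin (n k)) K, ∀ a ∈ filtration K S j,
      rk (φ k a - M.val * ψ k a * (M⁻¹).val) ≤ ε := by
  rcases subsingleton_or_nontrivial A with hA' | hA'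
  · refine Filter.Eventually.of_forall fun k => ⟨1, fun a _ => ?_⟩
    rw [Subsingleton.elim a 0]
    simpa [rk_zero] using hε.le
  obtain ⟨W, hWfin, hW0, hW⟩ := hA.exists_le_finrank_interior (filtration K S j)
    (one_mem_filtration hS j) (η := ε / 3) (by positivity)
  obtain ⟨w, hw⟩ := exists_le_filtration hS hgen W
  obtain ⟨N, hN⟩ := exists_nat_ge (3 * finrank K W / ε)
  obtain ⟨m, hm⟩ : ∃ m, FiniteDimensional K A ∧ filtration K S m = ⊤ ∨
      ¬ FiniteDimensional K A ∧ N ≤ finrank K (filtration K S m) := by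
    by_cases hfin : FiniteDimensional K A
    · obtain ⟨m, hm⟩ := exists_le_filtration hS hgen (⊤ : Submodule K A)
      exact ⟨m, Or.inl ⟨hfin, top_le_iff.1 hm⟩⟩
    · obtain ⟨m, hm⟩ := exists_le_finrank_filtration hS hgen hfin N
      exact ⟨m, Or.inr ⟨hfin, hm⟩⟩
  obtain ⟨p, hp⟩ := exists_nat_ge (6 / ε)
  -- `j` and `w` put `V` and `W` in the filtration, `N` forces `n < d` for small sizes, `m` makes
  -- the filtration everything or of dimension at least `N`, `p` gives `2 / d ≤ ε / 3`, and `2`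
  -- ensures `2 * (n / d) ≤ n`.
  set d := j + w + N + m + p + 2 with hd
  have hd0 : 0 < d := by omega
  filter_upwards [hφ.2 d hd0, hψ.2 d hd0] with k hφk hψk
  have hn := hφ.1 k
  have hn' : (0 : ℝ) < n k := by exact_mod_cast hn
  have hmd := filtration_mono (K := K) hS (show m ≤ d by omega)
  rcases lt_or_ge (n k) N with hnN | hnN
  · rcases hm with ⟨hfin, htop⟩ | ⟨-, hle⟩
    · obtain ⟨M, hM⟩ := exists_conj_eq hφk hψk (by omega) (top_le_iff.1 (htop ▸ hmd))
      exact ⟨M, fun a _ => by rw [hM, rk_zero]; exact hε.le⟩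
    · have h1 := hφk.finrank_filtration_le hn (by omega)
      have h2 := Submodule.finrank_mono hmd
      omega
  · set D := finrank K W with hD
    set r := (n k - 2 * (n k / d)) / D with hr
    have hrD : r * D ≤ n k - 2 * (n k / d) := Nat.div_mul_le_self _ _
    have hrD' : n k - 2 * (n k / d) ≤ r * D + D := by
      have : n k - 2 * (n k / d) < r * D + D :=
        Nat.lt_div_mul_add hW0 (a := n k - 2 * (n k / d))
      omega
    have hd2 : 2 * (n k / d) ≤ n k := by
      have := Nat.div_le_div_left (show 2 ≤ d by omega) two_pos (a := n k)
      omega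
    obtain ⟨M, hM⟩ := exists_rank_sub_conj_le hφk hψk hd0 (V := filtration K S j) (W := W)
      (filtration_mono hS (by omega)) (hw.trans (filtration_mono hS (by omega))) (r := r)
      (by change r * D + _ ≤ _; omega)
    refine ⟨M, fun a ha => ?_⟩
    rw [rk, div_le_iff₀ hn']
    have h1 : ((φ k a - M.val * ψ k a * (M⁻¹).val).rank : ℝ) +
        r * finrank K (interior (filtration K S j) W) ≤ n k := by exact_mod_cast hM a ha
    have h2 : (n k : ℝ) ≤ r * D + D + 2 * (n k / d) := by
      have h3 : n k ≤ r * D + D + 2 * (n k / d) := by omega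
      have h4 : (n k : ℝ) ≤ r * D + D + 2 * (n k / d : ℕ) := by exact_mod_cast h3
      exact h4.trans (by gcongr; exact Nat.cast_div_le)
    have h3 : (r : ℝ) * D ≤ n k := by
      have : r * D ≤ n k := by omega
      exact_mod_cast this
    have h4 : 2 * ((n k : ℝ) / d) ≤ ε / 3 * n k := by
      have : (6 / ε) ≤ d := hp.trans (by exact_mod_cast (show p ≤ d by omega))
      rw [div_le_iff₀ hε] at this
      rw [← mul_div_assoc, div_le_iff₀ (by exact_mod_cast hd0)]
      nlinarith
    have h5 : (D : ℝ) ≤ ε / 3 * n k := by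
      have : 3 * (D : ℝ) / ε ≤ n k := hN.trans (by exact_mod_cast hnN)
      rw [div_le_iff₀ hε] at this
      linarith
    have h6 : (r : ℝ) * ((1 - ε / 3) * D) ≤ r * finrank K (interior (filtration K S j) W) := by
      gcongr
    have h7 : ε / 3 * (r * D) ≤ ε / 3 * n k := by gcongr
    linarith

/-! ### Passage to the metric ultraproduct -/

open Filter Topology in
theorem toUltraproduct_eq_iff {n : ℕ → ℕ} {ω : Ultrafilter ℕ}
    {x y : ∀ k, Matrix (Fin (n k)) (Fin (n k)) K} :
    toUltraproduct ω x = toUltraproduct ω y ↔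
      Tendsto (fun k => rk (x k - y k)) (ω : Filter ℕ) (𝓝 0) := by
  rw [toUltraproduct, RingCon.coe_mk', RingCon.eq, TwoSidedIdeal.rel_iff, nullIdeal,
    TwoSidedIdeal.mem_mk']
  rfl

-- A single conjugator must serve all `a` at once. At stage `k` it is taken for the largest level `j
-- ≤ k` at which an approximate conjugator with error `1 / (j + 1)` exists; this level tends to
-- infinity, so every `a` is eventually covered with vanishing error.
open Filter Topology in
theorem areConjugate [NoZeroDivisors A] (hS : (1 : A) ∈ S)
    (hgen : Algebra.adjoin K (S : Set A) = ⊤) (hA : IsAmenable K A) {n : ℕ → ℕ}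
    {φ ψ : ∀ k, A →ₗ[K] Matrix (Fin (n k)) (Fin (n k)) K}
    (hφ : IsLinearSoficApproximation S φ) (hψ : IsLinearSoficApproximation S ψ)
    (ω : Ultrafilter ℕ) (hω : (ω : Filter ℕ) ≤ cofinite) : AreConjugate ω φ ψ := by
  classical
  let Q : ℕ → ℕ → Prop := fun j k => ∃ M : GL (Fin (n k)) K, ∀ a ∈ filtration K S j,
    rk (φ k a - M.val * ψ k a * (M⁻¹).val) ≤ 1 / ((j : ℝ) + 1)
  have hQ : ∀ j, ∀ᶠ k in atTop, Q j k := fun j =>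
    eventually_exists_rk_sub_conj_le hS hgen hA hφ hψ j (by positivity)
  let t : ℕ → ℕ := fun k => Nat.findGreatest (Q · k) k
  -- `Nat.findGreatest` returns `0` when no level works, so `Q (t k) k` may fail; the default `1` is
  -- then used, which happens for only finitely many `k`.
  let M : ∀ k, GL (Fin (n k)) K := fun k => if h : Q (t k) k then h.choose else 1
  refine ⟨M, fun a => ?_⟩
  rw [← map_mul, ← map_mul, toUltraproduct_eq_iff]
  refine Tendsto.mono_left ?_ (hω.trans Nat.cofinite_eq_atTop.le)
  obtain ⟨m, hm⟩ := exists_mem_filtration (K := K) hS hgen a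
  refine squeeze_zero' (g := fun k => 1 / ((t k : ℝ) + 1))
    (Eventually.of_forall fun k => rk_nonneg _) ?_
    (tendsto_one_div_add_atTop_nhds_zero_nat.comp (tendsto_atTop.2 fun j => ?_))
  · filter_upwards [hQ m, eventually_ge_atTop m] with k hk hmk
    have h1 : Q (t k) k := Nat.findGreatest_spec (P := (Q · k)) hmk hk
    have h2 : m ≤ t k := Nat.le_findGreatest hmk hk
    have h3 : M k = h1.choose := dif_pos h1
    have h4 := h1.choose_spec a (filtration_mono hS h2 hm)
    rw [← h3] at h4
    exact h4
  · filter_upwards [hQ j, eventually_ge_atTop j] with k hk hjk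
    exact Nat.le_findGreatest hjk hk

end Conjugacy

end LinearSofic

theorem theorem1p1 {K : Type*} [Field K] {A : Type*} [Ring A] [Algebra K A] [NoZeroDivisors A]
    (S : Finset A) (hS_one : (1 : A) ∈ S) (hS_gen : Algebra.adjoin K (S : Set A) = ⊤)
    (hA : LinearSofic.IsAmenable K A) :
    (∃ (n : ℕ → ℕ) (φ : ∀ k, A →ₗ[K] Matrix (Fin (n k)) (Fin (n k)) K),
      LinearSofic.IsLinearSoficApproximation S φ) ∧
    (∀ (n : ℕ → ℕ) (φ ψ : ∀ k, A →ₗ[K] Matrix (Fin (n k)) (Fin (n k)) K),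
      LinearSofic.IsLinearSoficApproximation S φ → LinearSofic.IsLinearSoficApproximation S ψ →
        ∀ ω : Ultrafilter ℕ, (ω : Filter ℕ) ≤ Filter.cofinite →
          LinearSofic.AreConjugate ω φ ψ) :=
  ⟨LinearSofic.exists_isLinearSoficApproximation hS_one hA,
    fun _ _ _ hφ hψ ω hω => LinearSofic.areConjugate hS_one hS_gen hA hφ hψ ω hω⟩
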